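/- Call a pair $(J,\mathcal B)$ a Borel space if $\mathcal B$ is the $\sigma$-algebra of Borel sets of some Polish topology on the set $J$. Let $\mathcal S$ be the class of all setfunctions $\varphi\colon\mathcal B\to\mathbb R$ on Borel spaces $(J,\mathcal B)$ (where $(J,\mathcal B)$ may depend on $\varphi$) which are increasing ($X\subseteq Y$ implies $\varphi(X)\le\varphi(Y)$), submodular ($\varphi(X\cap Y)+\varphi(X\cup Y)\le\varphi(X)+\varphi(Y)$ for all $X,Y\in\mathcal B$) and normalized ($\varphi(\emptyset)=0$ and $\varphi(J)=1$). No continuity of $\varphi$ is assumed. For $k\ge 1$ let $$Q_k(\varphi)=\{\varphi\circ F^{-1} : F\colon J\to\{1,\dots,k\}\ \text{measurable}\}\subseteq\mathbb R^{2^k},$$ where $\varphi\circ F^{-1}$ is the setfunction $A\mapsto\varphi(F^{-1}(A))$ on the subsets $A$ of $\{1,\dots,k\}$, viewed as a point of the $2^k$-dimensional Euclidean space, and let $d_{\mathrm H}^{k}$ be the Hausdorff distance of subsets of this Euclidean space. For $\varphi_1,\varphi_2\in\mathcal S$ the series $$d(\varphi_1,\varphi_2)=\sum_{k=1}^\infty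 2^{-k}\,d_{\mathrm H}^{k}\bigl(Q_k(\varphi_1),Q_k(\varphi_2)\bigr)$$ converges, and $d$ is a pseudometric on $\mathcal S$. Corollary. The pseudometric space $(\mathcal S,d)$ is compact. -/

import Mathlib

universe u

noncomputable section

namespace QuotientConvergence

/-- A setfunction on the sigma-algebra of measurable subsets of `J`. -/
abbrev SetFunction (J : Type u) [MeasurableSpace J] : Type u :=
  {X : Set J // MeasurableSet X} → ℝ

/-- Submodularity: `φ(X ∩ Y) + φ(X ∪ Y) ≤ φ(X) + φ(Y)`. -/
def IsSubmodular {J : Type u} [MeasurableSpace J] (φ : SetFunction J) : Prop :=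
  ∀ X Y : {X : Set J // MeasurableSet X}, φ (X ∩ Y) + φ (X ∪ Y) ≤ φ X + φ Y

/-- The quotient `φ ∘ F⁻¹` of `φ` by a measurable map `F : J → [k]`, a point of the
`2 ^ k`-dimensional Euclidean space (coordinates are indexed by the subsets of `[k]`). -/
def quotient {J : Type u} [MeasurableSpace J] (φ : SetFunction J) {k : ℕ}
    (F : J → Fin k) (hF : Measurable F) : EuclideanSpace ℝ (Set (Fin k)) :=
  WithLp.toLp 2 fun A => φ ⟨F ⁻¹' A, hF (MeasurableSet.of_discrete (s := A))⟩

/-- The `k`-quotient set `Q_k(φ)`. -/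
def quotientSet {J : Type u} [MeasurableSpace J] (φ : SetFunction J) (k : ℕ) :
    Set (EuclideanSpace ℝ (Set (Fin k))) :=
  {q | ∃ (F : J → Fin k) (hF : Measurable F), q = quotient φ F hF}

/-- An increasing normalized submodular setfunction on a (standard) Borel space. -/
structure NormalizedSubmodular : Type (u + 1) where
  /-- The underlying set. -/
  carrier : Type u
  [measurableSpace : MeasurableSpace carrier]
  [standardBorel : StandardBorelSpace carrier]
  /-- The setfunction. -/
  toFun : SetFunction carrier
  map_empty : toFun ∅ = 0
  map_univ : toFun ⟨Set.univ, MeasurableSet.univ⟩ = 1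
  increasing : ∀ X Y : {X : Set carrier // MeasurableSet X},
    (X : Set carrier) ⊆ Y → toFun X ≤ toFun Y
  submodular : IsSubmodular toFun

attribute [instance] NormalizedSubmodular.measurableSpace NormalizedSubmodular.standardBorel

namespace NormalizedSubmodular

/-- The `k`-quotient set of a member of the space. -/
def Q (φ : NormalizedSubmodular.{u}) (k : ℕ) : Set (EuclideanSpace ℝ (Set (Fin k))) :=
  quotientSet φ.toFun k

/-- The distance `d(φ, ψ) = ∑_{k ≥ 1} 2^{-k} d_H(Q_k(φ), Q_k(ψ))`; the summation index of the
code is `k - 1`. -/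
def quotientDist (φ ψ : NormalizedSubmodular.{u}) : ℝ :=
  ∑' n : ℕ, (2⁻¹ : ℝ) ^ (n + 1) * Metric.hausdorffDist (φ.Q (n + 1)) (ψ.Q (n + 1))

theorem carrier_nonempty (φ : NormalizedSubmodular.{u}) : Nonempty φ.carrier := by
  by_contra h
  rw [not_nonempty_iff] at h
  have h1 : (⟨Set.univ, MeasurableSet.univ⟩ : {X : Set φ.carrier // MeasurableSet X}) = ∅ :=
    Subtype.ext (Set.univ_eq_empty_iff.2 h)
  have h2 := φ.map_univ
  rw [h1, φ.map_empty] at h2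
  exact zero_ne_one h2

theorem toFun_nonneg (φ : NormalizedSubmodular.{u})
    (X : {X : Set φ.carrier // MeasurableSet X}) : 0 ≤ φ.toFun X := by
  rw [← φ.map_empty]
  exact φ.increasing _ _ (Set.empty_subset _)

theorem toFun_le_one (φ : NormalizedSubmodular.{u})
    (X : {X : Set φ.carrier // MeasurableSet X}) : φ.toFun X ≤ 1 := by
  rw [← φ.map_univ]
  exact φ.increasing _ _ (Set.subset_univ _)

theorem Q_nonempty (φ : NormalizedSubmodular.{u}) (n : ℕ) : (φ.Q (n + 1)).Nonempty :=
  ⟨_, fun _ => 0, measurable_const, rfl⟩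

theorem dist_le_of_mem_Q {φ ψ : NormalizedSubmodular.{u}} {k : ℕ}
    {x y : EuclideanSpace ℝ (Set (Fin k))} (hx : x ∈ φ.Q k) (hy : y ∈ ψ.Q k) :
    dist x y ≤ √2 ^ k := by
  obtain ⟨F, hF, rfl⟩ := hx
  obtain ⟨G, hG, rfl⟩ := hy
  rw [EuclideanSpace.dist_eq]
  have h2 : √2 ^ k = √((2 : ℝ) ^ k) := by
    rw [Real.sqrt_eq_rpow, Real.sqrt_eq_rpow, ← Real.rpow_natCast, ← Real.rpow_natCast,
      ← Real.rpow_mul (by norm_num), ← Real.rpow_mul (by norm_num), mul_comm]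
  rw [h2]
  apply Real.sqrt_le_sqrt
  calc ∑ A : Set (Fin k), dist (quotient φ.toFun F hF A) (quotient ψ.toFun G hG A) ^ 2
      ≤ ∑ _A : Set (Fin k), (1 : ℝ) := by
        refine Finset.sum_le_sum fun A _ => ?_
        have h : dist (quotient φ.toFun F hF A) (quotient ψ.toFun G hG A) ≤ 1 := by
          have a1 := φ.toFun_nonneg ⟨F ⁻¹' A, hF (MeasurableSet.of_discrete (s := A))⟩
          have a2 := φ.toFun_le_one ⟨F ⁻¹' A, hF (MeasurableSet.of_discrete (s := A))⟩
          have b1 := ψ.toFun_nonneg ⟨G ⁻¹' A, hG (MeasurableSet.of_discrete (s := A))⟩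
          have b2 := ψ.toFun_le_one ⟨G ⁻¹' A, hG (MeasurableSet.of_discrete (s := A))⟩
          rw [Real.dist_eq, abs_le]
          simp only [quotient]
          constructor <;> linarith
        exact pow_le_one₀ dist_nonneg h
    _ = 2 ^ k := by simp

theorem Q_isBounded (φ : NormalizedSubmodular.{u}) (k : ℕ) : Bornology.IsBounded (φ.Q k) :=
  Metric.isBounded_iff.2 ⟨√2 ^ k, fun _ hx _ hy => dist_le_of_mem_Q hx hy⟩

theorem hausdorffDist_Q_le (φ ψ : NormalizedSubmodular.{u}) (n : ℕ) :
    Metric.hausdorffDist (φ.Q (n + 1)) (ψ.Q (n + 1)) ≤ √2 ^ (n + 1) := by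
  obtain ⟨a, ha⟩ := φ.Q_nonempty n
  obtain ⟨b, hb⟩ := ψ.Q_nonempty n
  refine Metric.hausdorffDist_le_of_mem_dist (by positivity) (fun x hx => ⟨b, hb, ?_⟩)
    (fun x hx => ⟨a, ha, ?_⟩)
  · exact dist_le_of_mem_Q hx hb
  · exact dist_le_of_mem_Q hx ha

/-- The series defining the distance converges. -/
theorem summable_quotientDist (φ ψ : NormalizedSubmodular.{u}) :
    Summable fun n : ℕ =>
      (2⁻¹ : ℝ) ^ (n + 1) * Metric.hausdorffDist (φ.Q (n + 1)) (ψ.Q (n + 1)) := by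
  have hlt : 2⁻¹ * √2 < 1 := by
    have : √2 < 2 := by
      rw [Real.sqrt_lt' (by norm_num)]
      norm_num
    linarith
  have hs : Summable fun n : ℕ => (2⁻¹ * √2) ^ (n + 1) :=
    (summable_nat_add_iff 1).2 (summable_geometric_of_lt_one (by positivity) hlt)
  refine Summable.of_nonneg_of_le
    (fun n => mul_nonneg (by positivity) Metric.hausdorffDist_nonneg) (fun n => ?_) hs
  rw [mul_pow]
  exact mul_le_mul_of_nonneg_left (hausdorffDist_Q_le φ ψ n) (by positivity)

/-- The space of all increasing normalized submodular setfunctions on Borel spaces, with the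
pseudometric `quotientDist` (and the topology it induces). -/
instance instPseudoMetricSpace : PseudoMetricSpace NormalizedSubmodular.{u} where
  dist := quotientDist
  dist_self φ := by
    simp [quotientDist, Metric.hausdorffDist_self_zero]
  dist_comm φ ψ := by
    simp only [quotientDist, Metric.hausdorffDist_comm]
  dist_triangle φ ψ χ := by
    unfold quotientDist
    rw [← (summable_quotientDist φ ψ).tsum_add (summable_quotientDist ψ χ)]
    refine (summable_quotientDist φ χ).tsum_le_tsum (fun n => ?_)
      ((summable_quotientDist φ ψ).add (summable_quotientDist ψ χ))
    rw [← mul_add]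
    refine mul_le_mul_of_nonneg_left (Metric.hausdorffDist_triangle ?_) (by positivity)
    exact Metric.hausdorffEDist_ne_top_of_nonempty_of_bounded (φ.Q_nonempty n) (ψ.Q_nonempty n)
      (φ.Q_isBounded _) (ψ.Q_isBounded _)

end NormalizedSubmodular

end QuotientConvergence

end

open Filter Topology

/-! Since no continuity is required of a setfunction, a sequence `φ n` has a limit along any
ultrafilter `U`: on the disjoint union of the carriers, let the value at `X` be the `U`-limit of the
values of `φ n` at the slices of `X`. Weak inequalities survive the limit. Measurable maps from the
union to `Fin k` are exactly sequences of measurable maps on the pieces, so each quotient of the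
limit is a `U`-limit of quotients of `φ n`, and any choice of quotients of the `φ n` glues to one of
the limit. With boundedness this gives Hausdorff convergence of each `Q k`, hence convergence in
`d`; a nonprincipal `U` then yields a convergent subsequence. -/

/-- A countable disjoint union of standard Borel spaces is standard Borel. -/
theorem StandardBorelSpace.sigma {ι : Type*} [Countable ι] {α : ι → Type*}
    [∀ i, MeasurableSpace (α i)] [∀ i, StandardBorelSpace (α i)] :
    StandardBorelSpace (Σ i, α i) := by
  let := fun i => upgradeStandardBorel (α i)
  have hB : BorelSpace (Σ i, α i) := by
    refine ⟨le_antisymm ?_ ?_⟩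
    · intro s hs
      have hs' : ∀ i, MeasurableSet (Sigma.mk i ⁻¹' s) := fun i =>
        (MeasurableSpace.measurableSet_iInf.1 hs) i
      let m : MeasurableSpace (Σ i, α i) := borel _
      have : BorelSpace (Σ i, α i) := ⟨rfl⟩
      have h : s = ⋃ i, Sigma.mk i '' (Sigma.mk i ⁻¹' s) := by
        ext ⟨i, x⟩
        simp only [Set.mem_iUnion, Set.mem_image, Set.mem_preimage]
        constructor
        · exact fun hx => ⟨i, x, hx, rfl⟩
        · rintro ⟨j, y, hy, h⟩
          rwa [← h]
      change @MeasurableSet _ m s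
      rw [h]
      -- Each piece is closed in the union, so its Borel sets remain Borel there.
      exact MeasurableSet.iUnion fun i =>
        Topology.IsClosedEmbedding.sigmaMk.measurableEmbedding.measurableSet_image.2 (hs' i)
    · refine MeasurableSpace.generateFrom_le fun s hs => ?_
      exact MeasurableSpace.measurableSet_iInf.2 fun i =>
        (isOpen_sigma_iff.1 hs i).measurableSet
  exact ⟨inferInstance, hB, inferInstance⟩

theorem measurable_sigmaMk {ι : Type*} {α : ι → Type*} [∀ i, MeasurableSpace (α i)] (i : ι) :
    Measurable (Sigma.mk i : α i → Σ i, α i) :=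
  fun _ hs => MeasurableSpace.measurableSet_iInf.1 hs i

theorem measurable_sigma {ι β : Type*} {α : ι → Type*} [∀ i, MeasurableSpace (α i)]
    [MeasurableSpace β] {f : (Σ i, α i) → β} (hf : ∀ i, Measurable fun x => f ⟨i, x⟩) :
    Measurable f :=
  fun _ hs => MeasurableSpace.measurableSet_iInf.2 fun i => hf i hs

namespace QuotientConvergence

namespace NormalizedSubmodular

variable (φ : ℕ → NormalizedSubmodular.{u})

/-- The `n`-th slice of a measurable subset of a disjoint union. -/
def slice (X : {X : Set (Σ n, (φ n).carrier) // MeasurableSet X}) (n : ℕ) :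
    {X : Set (φ n).carrier // MeasurableSet X} :=
  ⟨(fun x => ⟨n, x⟩) ⁻¹' (X : Set (Σ n, (φ n).carrier)), measurable_sigmaMk n X.2⟩

theorem exists_tendsto_slice (U : Ultrafilter ℕ)
    (X : {X : Set (Σ n, (φ n).carrier) // MeasurableSet X}) :
    ∃ x, Tendsto (fun n => (φ n).toFun (slice φ X n)) U (𝓝 x) := by
  obtain ⟨x, -, hx⟩ := (isCompact_Icc (a := (0 : ℝ)) (b := 1)).ultrafilter_le_nhds'
    (U.map fun n => (φ n).toFun (slice φ X n))
    (Ultrafilter.mem_map.2 (Filter.univ_mem' fun n =>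
      ⟨(φ n).toFun_nonneg _, (φ n).toFun_le_one _⟩))
  exact ⟨x, hx⟩

/-- The limit along an ultrafilter of setfunctions, living on the disjoint union of their
carriers. -/
noncomputable def ultraLimitFun (U : Ultrafilter ℕ) : SetFunction (Σ n, (φ n).carrier) :=
  fun X => (exists_tendsto_slice φ U X).choose

theorem tendsto_ultraLimitFun (U : Ultrafilter ℕ)
    (X : {X : Set (Σ n, (φ n).carrier) // MeasurableSet X}) :
    Tendsto (fun n => (φ n).toFun (slice φ X n)) U (𝓝 (ultraLimitFun φ U X)) :=
  (exists_tendsto_slice φ U X).choose_spec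

/-- The ultrafilter limit as an increasing normalized submodular setfunction. -/
noncomputable def ultraLimit (U : Ultrafilter ℕ) : NormalizedSubmodular.{u} where
  carrier := Σ n, (φ n).carrier
  standardBorel := StandardBorelSpace.sigma
  toFun := ultraLimitFun φ U
  map_empty := tendsto_nhds_unique (tendsto_ultraLimitFun φ U ∅)
    (tendsto_const_nhds.congr fun n => (φ n).map_empty.symm)
  map_univ := tendsto_nhds_unique (tendsto_ultraLimitFun φ U _)
    (tendsto_const_nhds.congr fun n => (φ n).map_univ.symm)
  increasing X Y h := le_of_tendsto_of_tendsto' (tendsto_ultraLimitFun φ U X)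
    (tendsto_ultraLimitFun φ U Y) fun n => (φ n).increasing _ _ (Set.preimage_mono h)
  submodular X Y := le_of_tendsto_of_tendsto'
    ((tendsto_ultraLimitFun φ U (X ∩ Y)).add (tendsto_ultraLimitFun φ U (X ∪ Y)))
    ((tendsto_ultraLimitFun φ U X).add (tendsto_ultraLimitFun φ U Y))
    fun n => (φ n).submodular (slice φ X n) (slice φ Y n)

theorem tendsto_quotient_ultraLimit (U : Ultrafilter ℕ) {k : ℕ}
    (F : (Σ n, (φ n).carrier) → Fin k) (hF : Measurable F) :
    Tendsto (fun n => quotient (φ n).toFun (fun x => F ⟨n, x⟩) (hF.comp (measurable_sigmaMk n)))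
      U (𝓝 (quotient (ultraLimit φ U).toFun F hF)) :=
  ((PiLp.continuous_toLp 2 _).tendsto _).comp
    (tendsto_pi_nhds.2 fun A => tendsto_ultraLimitFun φ U ⟨F ⁻¹' A, _⟩)

/-- Convergence holds for one `F` at a time; a finite `ε / 2`-net of the bounded set `Q k` makes it
uniform. -/
theorem eventually_Q_ultraLimit_subset (U : Ultrafilter ℕ) (k : ℕ) {ε : ℝ} (hε : 0 < ε) :
    ∀ᶠ n in U, ∀ x ∈ (ultraLimit φ U).Q k, ∃ y ∈ (φ n).Q k, dist x y ≤ ε := by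
  obtain ⟨t, htQ, ht, hcov⟩ := Metric.finite_approx_of_totallyBounded
    (((ultraLimit φ U).Q_isBounded k).isCompact_closure.totallyBounded.subset subset_closure)
    (ε / 2) (half_pos hε)
  have h : ∀ᶠ n in U, ∀ x ∈ t, ∃ y ∈ (φ n).Q k, dist y x < ε / 2 := by
    refine (eventually_all_finite ht).2 fun x hx => ?_
    obtain ⟨F, hF, rfl⟩ := htQ hx
    filter_upwards [Metric.tendsto_nhds.1 (tendsto_quotient_ultraLimit φ U F hF) _ (half_pos hε)]
      with n hn
    exact ⟨_, ⟨_, _, rfl⟩, hn⟩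
  filter_upwards [h] with n hn x hx
  obtain ⟨z, hz, hxz⟩ := Set.mem_iUnion₂.1 (hcov hx)
  obtain ⟨y, hy, hyz⟩ := hn z hz
  refine ⟨y, hy, (dist_triangle_right x y z).trans ?_⟩
  rw [Metric.mem_ball] at hxz
  linarith

/-- No net is needed here: pick a worst quotient for every `n` and glue. The glued quotient of the
limit is `U`-eventually close to all of them, so bad quotients exist only for a `U`-null set of `n`.
-/
theorem eventually_Q_subset_Q_ultraLimit (U : Ultrafilter ℕ) (k : ℕ) {ε : ℝ} (hε : 0 < ε) :
    ∀ᶠ n in U, ∀ x ∈ (φ n).Q (k + 1), ∃ y ∈ (ultraLimit φ U).Q (k + 1), dist x y ≤ ε := by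
  have h : ∀ n, ∃ (F : (φ n).carrier → Fin (k + 1)) (hF : Measurable F),
      (∃ y ∈ (ultraLimit φ U).Q (k + 1), dist (quotient (φ n).toFun F hF) y ≤ ε) →
      ∀ x ∈ (φ n).Q (k + 1), ∃ y ∈ (ultraLimit φ U).Q (k + 1), dist x y ≤ ε := by
    intro n
    by_cases hn : ∀ x ∈ (φ n).Q (k + 1), ∃ y ∈ (ultraLimit φ U).Q (k + 1), dist x y ≤ ε
    -- If no quotient is bad, any map serves; `k + 1` ensures that one exists.
    · exact ⟨fun _ => 0, measurable_const, fun _ => hn⟩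
    · push Not at hn
      obtain ⟨x, ⟨F, hF, rfl⟩, hx⟩ := hn
      exact ⟨F, hF, fun ⟨y, hy, hxy⟩ => absurd hxy (hx y hy).not_ge⟩
  choose F hF hFn using h
  have hG : Measurable fun p : Σ n, (φ n).carrier => F p.1 p.2 := measurable_sigma hF
  filter_upwards [Metric.tendsto_nhds.1 (tendsto_quotient_ultraLimit φ U _ hG) ε hε] with n hn
  exact hFn n ⟨_, ⟨_, _, rfl⟩, hn.le⟩

theorem tendsto_hausdorffDist_ultraLimit (U : Ultrafilter ℕ) (k : ℕ) :
    Tendsto (fun n => Metric.hausdorffDist ((φ n).Q (k + 1)) ((ultraLimit φ U).Q (k + 1)))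
      U (𝓝 0) := by
  refine Metric.tendsto_nhds.2 fun ε hε => ?_
  filter_upwards [eventually_Q_ultraLimit_subset φ U (k + 1) (half_pos hε),
    eventually_Q_subset_Q_ultraLimit φ U k (half_pos hε)] with n h₁ h₂
  rw [Real.dist_0_eq_abs, abs_of_nonneg Metric.hausdorffDist_nonneg]
  exact (Metric.hausdorffDist_le_of_mem_dist (half_pos hε).le h₂ h₁).trans_lt (half_lt_self hε)

/-- A sequence converges along an ultrafilter to its ultrafilter limit. -/
theorem tendsto_ultraLimit (U : Ultrafilter ℕ) : Tendsto φ U (𝓝 (ultraLimit φ U)) := by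
  rw [tendsto_iff_dist_tendsto_zero]
  change Tendsto (fun n => quotientDist (φ n) (ultraLimit φ U)) U (𝓝 0)
  have hlt : 2⁻¹ * √2 < 1 := by
    have : √2 < 2 := (Real.sqrt_lt' (by norm_num)).2 (by norm_num)
    linarith
  have hs : Summable fun n : ℕ => (2⁻¹ * √2) ^ (n + 1) :=
    (summable_nat_add_iff 1).2 (summable_geometric_of_lt_one (by positivity) hlt)
  -- The bound `√2 ^ (k + 1)` on the Hausdorff distances is uniform in `n`, so the limit may be
  -- taken termwise.
  have h := tendsto_tsum_of_dominated_convergence (𝓕 := (U : Filter ℕ)) (g := fun _ : ℕ => (0 : ℝ))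
    (f := fun n k => (2⁻¹ : ℝ) ^ (k + 1) *
      Metric.hausdorffDist ((φ n).Q (k + 1)) ((ultraLimit φ U).Q (k + 1))) hs
    (fun k => by simpa using (tendsto_hausdorffDist_ultraLimit φ U k).const_mul ((2⁻¹ : ℝ) ^ (k + 1)))
    (Eventually.of_forall fun n k => by
      rw [Real.norm_of_nonneg (mul_nonneg (by positivity) Metric.hausdorffDist_nonneg), mul_pow]
      exact mul_le_mul_of_nonneg_left (hausdorffDist_Q_le _ _ k) (by positivity))
  simpa [quotientDist] using h

end NormalizedSubmodular

end QuotientConvergence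

theorem mainTheorem2 : CompactSpace QuotientConvergence.NormalizedSubmodular.{u} := by
  rw [compactSpace_iff_seqCompactSpace]
  refine ⟨fun φ _ => ?_⟩
  -- The hyperfilter refines `atTop`, so its limit is a cluster point of the sequence; first
  -- countability then gives a subsequence.
  have h : MapClusterPt (QuotientConvergence.NormalizedSubmodular.ultraLimit φ (hyperfilter ℕ))
      atTop φ :=
    (QuotientConvergence.NormalizedSubmodular.tendsto_ultraLimit φ _).mapClusterPt.mono
      Nat.hyperfilter_le_atTop
  exact ⟨_, Set.mem_univ _, h.tendsto_subseq⟩
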